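/- Let $(X,d)$ be a Polish space and let $d_L : X\times X\to[0,+\infty]$ be a Borel function which is an extended distance ($d_L(x,y)=0$ iff $x=y$, symmetric, triangle inequality). A geodesic of $(X,d_L)$ is a map $\gamma : I\to X$ on an interval $I\subset\mathbb R$ (of any kind) with $d_L(\gamma(s),\gamma(t))=|s-t|$ for all $s,t\in I$. Assume that (i) any two points $x,y$ with $d_L(x,y)<+\infty$ are joined by a geodesic; (ii) $(X,d_L)$ is non-branching: for all $0\le r<\infty$ and all $x,y$ with $d_L(x,y)=r/2$ there is at most one $z$ with $d_L(x,z)=r$ and $d_L(y,z)=r/2$; (iii) every geodesic is continuous with respect to $d$; (iv) geodesics are locally compact in $(X,d)$: for every geodesic $\gamma : I\to X$ and every point $x\in\gamma(I)$ there is $r>0$ such that $\gamma^{-1}(\bar B_r(x))$ is a compact subset of $\mathbb R$, where $\bar B_r(x)=\{y: d(x,y)\le r\}$. Let $\mu,\nu$ be Borel probability measures on $X$ and let $\pi$ be a transference plan between $\mu$ and $\nu$ with $\int d_L\,d\pi<+\infty$. Let $\Gamma\subset\{d_L<+\infty\}$ be a set on which $\pi$ is concentrated, which is $d_L$-cyclically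 monotone, that is, $\sum_{i=0}^n d_L(x_i,y_i)\le\sum_{i=0}^n d_L(x_{i+1},y_i)$ for all $n$ and all $(x_0,y_0),\dots,(x_n,y_n)\in\Gamma$, $x_{n+1}=x_0$, and which is an increasing countable union of compact sets $\Gamma_n$ such that each restriction of $d_L$ to $\Gamma_n$ is continuous. Define $$\Gamma' := \Big\{(x,y) : \exists\, I\ge 0,\ (w_i,z_i)\in\Gamma\ (0\le i\le I),\ w_0=w_{I+1}=x,\ z_I=y,\ \sum_{i=0}^I \big(d_L(w_{i+1},z_i)-d_L(w_i,z_i)\big)=0\Big\},$$ $$G := \big\{(x,y) : \exists\,(w,z)\in\Gamma',\ d_L(w,x)+d_L(x,y)+d_L(y,z)=d_L(w,z)\big\},\qquad R := G\cup G^{-1},$$ $$\mathcal T := \big\{x : \exists\, w\ne x,\ (w,x)\in G\big\}\cap\big\{x : \exists\, z\ne x,\ (x,z)\in G\big\}.$$ Then $R\cap(\mathcal T\times\mathcal T)$ is an equivalence relation on $\mathcal T$, the set $\mathcal T$ is $\mu$-measurable, and there is a $\mu$-measurable cross section $f:\mathcal T\to\mathcal T$ of this relation: $(x,f(x))\in R$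 for all $x\in\mathcal T$, $f(x)=f(y)$ whenever $(x,y)\in R$, and the preimage under $f$ of each Borel subset of $\mathcal T$ is $\mu$-measurable. Moreover (equivalently), the disintegration of $\mu\llcorner_{\mathcal T}$ along the transport rays is strongly consistent. That is, let $r:\mathcal T\to S$ be the quotient map onto the set $S$ of equivalence classes, let $\mathscr S$ be the $\sigma$-algebra of all $C\subset S$ such that $r^{-1}(C)$ is $\mu$-measurable, and let $\eta(C)=\mu(r^{-1}(C))$ for $C\in\mathscr S$. Then there are Borel probability measures $(\mu_s)_{s\in S}$ on $\mathcal T$ such that $s\mapsto\mu_s(B)$ is $\mathscr S$-measurable and $\mu(B\cap r^{-1}(C))=\int_C\mu_s(B)\,\eta(ds)$ for every Borel $B\subset\mathcal T$ and every $C\in\mathscr S$, and $\mu_s(r^{-1}(s))=1$ for every $s\in S$. -/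

import Mathlib

open MeasureTheory Set
open scoped ENNReal

namespace RayMonge

variable {X : Type*}

/-! ### The intrinsic distance and its geodesics -/

/-- `dL` is a distance on `X` with values in `[0, +∞]`. -/
structure IsExtendedDistance (dL : X → X → ℝ≥0∞) : Prop where
  eq_zero_iff : ∀ x y, dL x y = 0 ↔ x = y
  symm : ∀ x y, dL x y = dL y x
  triangle : ∀ x y z, dL x z ≤ dL x y + dL y z

/-- `γ`, restricted to the interval `I ⊆ ℝ` (bounded or not, with or without its end points), is a
geodesic of `(X, dL)` parametrized by arc length: the length of `γ` between any two of its points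
is their distance. The values of `γ` outside `I` are irrelevant. -/
def IsGeodesic (dL : X → X → ℝ≥0∞) (I : Set ℝ) (γ : ℝ → X) : Prop :=
  I.OrdConnected ∧ ∀ s ∈ I, ∀ t ∈ I, dL (γ s) (γ t) = ENNReal.ofReal |s - t|

/-- `(X, dL)` is a geodesic space: any two points at finite distance are joined by a geodesic. -/
def IsGeodesicSpace (dL : X → X → ℝ≥0∞) : Prop :=
  ∀ x y, dL x y ≠ ∞ → ∃ γ : ℝ → X,
    IsGeodesic dL (Icc 0 (dL x y).toReal) γ ∧ γ 0 = x ∧ γ (dL x y).toReal = y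

/-- `(X, dL)` is non-branching (`dL` is strictly convex): if `dL x y = r / 2`, then there is at most
one point `z` at distance `r` from `x` and at distance `r / 2` from `y`. -/
def IsNonBranching (dL : X → X → ℝ≥0∞) : Prop :=
  ∀ r : ℝ, 0 ≤ r → ∀ x y, dL x y = ENNReal.ofReal (r / 2) →
    ({z | dL x z = ENNReal.ofReal r} ∩ {z | dL y z = ENNReal.ofReal (r / 2)}).Subsingleton

/-- The geodesics of `(X, dL)` are continuous with respect to the metric `d` of `X`. -/
def GeodesicsContinuous [MetricSpace X] (dL : X → X → ℝ≥0∞) : Prop :=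
  ∀ (I : Set ℝ) (γ : ℝ → X), IsGeodesic dL I γ → ContinuousOn γ I

/-- The geodesics of `(X, dL)` are locally compact in `(X, d)`: for each point `x` of a geodesic
`γ` there is `r > 0` such that the preimage under `γ` of the closed `d`-ball of radius `r` around
`x` is a compact subset of `ℝ`. -/
def GeodesicsLocallyCompact [MetricSpace X] (dL : X → X → ℝ≥0∞) : Prop :=
  ∀ (I : Set ℝ) (γ : ℝ → X), IsGeodesic dL I γ →
    ∀ t ∈ I, ∃ r : ℝ, 0 < r ∧ IsCompact (I ∩ γ ⁻¹' Metric.closedBall (γ t) r)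

/-! ### Transference plans -/

/-- `Γ` is `dL`-cyclically monotone. Addition in `Fin (n + 1)` is cyclic. -/
def CyclicallyMonotone (dL : X → X → ℝ≥0∞) (Γ : Set (X × X)) : Prop :=
  ∀ (n : ℕ) (p : Fin (n + 1) → X × X), (∀ i, p i ∈ Γ) →
    ∑ i, dL (p i).1 (p i).2 ≤ ∑ i, dL (p (i + 1)).1 (p i).2

/-- `π` is a transference plan between `μ` and `ν`. -/
def IsTransferencePlan [MeasurableSpace X] (μ ν : Measure X) (π : Measure (X × X)) : Prop :=
  π.map Prod.fst = μ ∧ π.map Prod.snd = ν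

/-- `Γ` is a `σ`-compact, `dL`-cyclically monotone set on which `π` is concentrated, on which `dL`
is finite, and which is an increasing union of compact sets on each of which `dL` is continuous. -/
structure IsCarrier [MetricSpace X] [MeasurableSpace X] (dL : X → X → ℝ≥0∞)
    (π : Measure (X × X)) (Γ : Set (X × X)) : Prop where
  exhaustion : ∃ Γn : ℕ → Set (X × X), Monotone Γn ∧ Γ = ⋃ n, Γn n ∧
    ∀ n, IsCompact (Γn n) ∧ ContinuousOn (fun p : X × X => dL p.1 p.2) (Γn n)
  cyclicallyMonotone : CyclicallyMonotone dL Γ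
  finite : ∀ p ∈ Γ, dL p.1 p.2 ≠ ∞
  concentrated : π Γᶜ = 0

/-! ### Transport rays and the transport set -/

/-- The set `Γ'` of the pairs `(x, y)` such that `x` is the first point and `y` is the last point
of a cycle of pairs `(w i, z i)` of `Γ` of total cost zero. As `dL` is finite on `Γ`, equality of
the two sums is the vanishing of `∑ i, (dL (w (i + 1)) (z i) - dL (w i) (z i))`. -/
def cycleSet (dL : X → X → ℝ≥0∞) (Γ : Set (X × X)) : Set (X × X) :=
  {q | ∃ (n : ℕ) (p : Fin (n + 1) → X × X), (∀ i, p i ∈ Γ) ∧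
    (p 0).1 = q.1 ∧ (p (Fin.last n)).2 = q.2 ∧
    ∑ i, dL (p (i + 1)).1 (p i).2 = ∑ i, dL (p i).1 (p i).2}

/-- The set `G` of oriented transport rays. -/
def orientedRays (dL : X → X → ℝ≥0∞) (Γ : Set (X × X)) : Set (X × X) :=
  {q | ∃ p ∈ cycleSet dL Γ, dL p.1 q.1 + dL q.1 q.2 + dL q.2 p.2 = dL p.1 p.2}

/-- The set `R = G ∪ G⁻¹` of transport rays. -/
def rays (dL : X → X → ℝ≥0∞) (Γ : Set (X × X)) : Set (X × X) :=
  orientedRays dL Γ ∪ Prod.swap ⁻¹' orientedRays dL Γ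

/-- The transport set `𝒯` (without end points). -/
def transportSet (dL : X → X → ℝ≥0∞) (Γ : Set (X × X)) : Set X :=
  {x | (∃ w, w ≠ x ∧ (w, x) ∈ orientedRays dL Γ) ∧ (∃ z, z ≠ x ∧ (x, z) ∈ orientedRays dL Γ)}

/-- The relation `R` on the transport set. -/
def rayRel (dL : X → X → ℝ≥0∞) (Γ : Set (X × X)) (x y : transportSet dL Γ) : Prop :=
  ((x : X), (y : X)) ∈ rays dL Γ

/-- `f` is a cross section of the relation `E`: it selects one point in each class. -/
def IsCrossSection {Ω : Type*} (E : Ω → Ω → Prop) (f : Ω → Ω) : Prop :=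
  (∀ x, E x (f x)) ∧ ∀ x y, E x y → f x = f y

/-! ### Disintegrations -/

/-- The push forward `σ`-algebra on `S` of the `σ`-algebra of `ρ`-measurable sets under `r`: a set
`C` belongs to it if and only if `r ⁻¹' C` is `ρ`-measurable. -/
abbrev quotientSpace {Ω S : Type*} [MeasurableSpace Ω] (ρ : Measure Ω) (r : Ω → S) :
    MeasurableSpace S :=
  MeasurableSpace.map r (inferInstanceAs (MeasurableSpace (NullMeasurableSpace Ω ρ)))

/-- The push forward measure `C ↦ ρ (r ⁻¹' C)` on the push forward `σ`-algebra. -/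
noncomputable def quotientMeasure {Ω S : Type*} [MeasurableSpace Ω] (ρ : Measure Ω) (r : Ω → S) :
    @Measure S (quotientSpace ρ r) :=
  @Measure.map (NullMeasurableSpace Ω ρ) S _ (quotientSpace ρ r) r ρ.completion

/-- `κ` is a disintegration of `ρ` which is strongly consistent with `r`. -/
structure IsStronglyConsistentDisintegration {Ω S : Type*} [MeasurableSpace Ω] (ρ : Measure Ω)
    (r : Ω → S) (κ : S → Measure Ω) : Prop where
  isProbabilityMeasure : ∀ s, IsProbabilityMeasure (κ s)
  measurable : ∀ B : Set Ω, MeasurableSet B → Measurable[quotientSpace ρ r] fun s => κ s B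
  consistent : ∀ B : Set Ω, MeasurableSet B → ∀ C : Set S, MeasurableSet[quotientSpace ρ r] C →
    ρ (B ∩ r ⁻¹' C) = ∫⁻ s in C, κ s B ∂(quotientMeasure ρ r)
  strong : ∀ s, κ s (r ⁻¹' {s}) = 1

end RayMonge

namespace RayMonge

/-! ### Universal measurability of analytic sets -/

/-! A pair `(x, y)` lies on an oriented ray exactly when some chain of pairs of `Γ` leads from `y`
back to `x` at cost `-dL x y`, the least that cyclical monotonicity allows (`mem_orientedRays_iff`).
Concatenating chains and using the triangle inequality shows that `G` is transitive, that `dL` is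
additive along it, and that it contains all intermediate points (`isRayOrder_orientedRays`).
Non-branching makes two rays through a common interior point comparable, so `R` is an equivalence
relation on the transport set (`rays_trans`).

The signed distance from a point identifies its class isometrically with an interval, so the class
is a geodesic and, by local compactness, locally closed for `d`. A class is therefore determined by
the members of a countable basis that it meets (`mem_rays_iff_forall_basis`). The set of points
whose class meets a given open set is a projection of an analytic set, hence `μ`-measurable by
compact inner approximation.

Coding the basis sets met by a class as a real number gives a function whose fibres are exactly the
classes, and which is Borel on a Borel subset of full measure in the transport set. A Borel section
of this function yields the cross section; the conditional law of the identity given this function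
yields the disintegration. On the remaining null set of classes, arbitrary representatives and Dirac
masses are used. -/

theorem isCompact_box (k : ℕ → ℕ) : IsCompact {x : ℕ → ℕ | ∀ i, x i ≤ k i} := by
  have := isCompact_univ_pi (fun i => (Set.finite_Iic (k i)).isCompact)
  convert this using 1
  ext x; simp [Pi.le_def]

/-- An open set of sequences which contains the compact box `{x | ∀ i, x i ≤ k i}` also
contains one of the sets `{x | ∀ i < n, x i ≤ k i}`. -/
theorem exists_initialBox_subset {k : ℕ → ℕ} {V : Set (ℕ → ℕ)} (hV : IsOpen V)
    (hK : {x : ℕ → ℕ | ∀ i, x i ≤ k i} ⊆ V) :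
    ∃ n, {x : ℕ → ℕ | ∀ i < n, x i ≤ k i} ⊆ V := by
  have hm : ∀ y ∈ V, ∃ m, PiNat.cylinder y m ⊆ V := fun y hy => by
    obtain ⟨m, hm⟩ := (PiNat.isTopologicalBasis_cylinders (fun _ => ℕ)).exists_subset_of_mem_open
      hy hV
    obtain ⟨⟨z, n, rfl⟩, hyz, hsub⟩ := hm
    exact ⟨n, by rwa [PiNat.mem_cylinder_iff_eq.1 hyz]⟩
  choose! m hm using hm
  obtain ⟨t, ht, hcov⟩ := (isCompact_box k).elim_nhds_subcover (fun y => PiNat.cylinder y (m y))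
    (fun y _ => (PiNat.isOpen_cylinder (fun _ => ℕ) y (m y)).mem_nhds (PiNat.self_mem_cylinder y _))
  refine ⟨t.sup m, fun x hx => ?_⟩
  -- The truncation of `x` lies in the box and agrees with `x` on the first `t.sup m` coordinates,
  -- so the cylinder that covers it contains `x` too.
  have hy : (fun i => min (x i) (k i)) ∈ {x : ℕ → ℕ | ∀ i, x i ≤ k i} := fun i => min_le_right _ _
  obtain ⟨y, hyt, hyx⟩ := mem_iUnion₂.1 (hcov hy)
  refine hm y (hK (ht y hyt)) ?_
  intro i hi
  rw [← hyx i hi]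
  exact (min_eq_left (hx i (hi.trans_le (Finset.le_sup hyt)))).symm

/-- An analytic set can be approximated from inside by compact sets. -/
theorem exists_isCompact_subset_lt_of_analyticSet {X : Type*} [TopologicalSpace X]
    [MeasurableSpace X] (μ : Measure X) [μ.OuterRegular] {A : Set X} (hA : AnalyticSet A)
    {c : ℝ≥0∞} (hc : c < μ A) : ∃ K ⊆ A, IsCompact K ∧ c ≤ μ K := by
  rw [AnalyticSet] at hA
  obtain rfl | ⟨f, hf, rfl⟩ := hA
  · simp at hc
  let S : (n : ℕ) → (ℕ → ℕ) → Set (ℕ → ℕ) := fun n k => {x | ∀ i < n, x i ≤ k i}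
  -- Bounding one more coordinate costs arbitrarily little: the images increase with the bound, and
  -- continuity from below holds for nonmeasurable sets as well.
  have step : ∀ (n : ℕ) (k : ℕ → ℕ), c < μ (f '' S n k) →
      ∃ b, c < μ (f '' S (n + 1) (Function.update k n b)) := by
    intro n k hk
    have hU : f '' S n k = ⋃ b, f '' S (n + 1) (Function.update k n b) := by
      rw [← image_iUnion]
      congr 1
      ext x
      simp only [S, mem_iUnion, mem_ofPred_eq]
      constructor
      · refine fun h => ⟨x n, fun i hi => ?_⟩
        rcases eq_or_ne i n with rfl | hne
        · simp
        · rw [Function.update_of_ne hne]; exact h i (by omega)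
      · rintro ⟨b, h⟩ i hi
        have := h i (by omega)
        rwa [Function.update_of_ne (by omega)] at this
    have hmono : Monotone fun b => f '' S (n + 1) (Function.update k n b) := by
      intro b b' hbb
      refine image_mono fun x hx i hi => (hx i hi).trans ?_
      rcases eq_or_ne i n with rfl | hne
      · simpa using hbb
      · simp [Function.update_of_ne hne]
    rw [hU, hmono.measure_iUnion] at hk
    exact lt_iSup_iff.1 hk
  choose! b hb using step
  let K : ℕ → (ℕ → ℕ) := fun n => Nat.rec (fun _ => 0) (fun n k => Function.update k n (b n k)) n
  have hKs : ∀ n, K (n + 1) = Function.update (K n) n (b n (K n)) := fun n => rfl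
  have hK : ∀ n, c < μ (f '' S n (K n)) := by
    intro n
    induction n with
    | zero => simpa [S, image_univ] using hc
    | succ n ih => exact hb n _ ih
  let k : ℕ → ℕ := fun i => K (i + 1) i
  have hKk : ∀ n i, i < n → K n i = k i := by
    intro n i hi
    induction n, hi using Nat.le_induction with
    | base => rfl
    | succ n hn ih => rw [hKs, Function.update_of_ne (by omega), ih]
  have hS : ∀ n, S n (K n) = S n k := fun n => by
    ext x
    exact forall₂_congr fun i hi => by rw [hKk n i hi]
  refine ⟨f '' {x | ∀ i, x i ≤ k i}, image_subset_range _ _, (isCompact_box k).image hf, ?_⟩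
  by_contra! hlt
  -- Outer regularity would give an open set of measure below `c` around the compact image, and this
  -- set would already contain the image of some `S n k`, of measure above `c`.
  obtain ⟨U, hU, hUo, hUc⟩ := Set.exists_isOpen_lt_of_lt _ _ hlt
  obtain ⟨n, hn⟩ := exists_initialBox_subset (hUo.preimage hf) (image_subset_iff.1 hU)
  have := (hK n).trans_le (measure_mono (image_subset_iff.2 ((hS n).trans_subset hn)))
  exact absurd this hUc.not_gt

/-- Analytic sets are universally measurable. -/
theorem nullMeasurableSet_of_analyticSet {X : Type*} [TopologicalSpace X] [T2Space X]
    [MeasurableSpace X] [OpensMeasurableSpace X] (μ : Measure X) [IsFiniteMeasure μ]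
    [μ.OuterRegular] {A : Set X} (hA : AnalyticSet A) : NullMeasurableSet A μ := by
  rcases eq_or_ne (μ A) 0 with h0 | h0
  · exact NullMeasurableSet.of_null h0
  obtain ⟨u, -, hu, hlim⟩ := exists_seq_strictMono_tendsto' (pos_iff_ne_zero.2 h0)
  choose K hKA hK hKu using fun n => exists_isCompact_subset_lt_of_analyticSet μ hA (hu n).2
  have hsub : (⋃ n, K n) ⊆ A := iUnion_subset hKA
  have hm : MeasurableSet (⋃ n, K n) := MeasurableSet.iUnion fun n => (hK n).measurableSet
  have hle : μ A ≤ μ (⋃ n, K n) :=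
    le_of_tendsto' hlim fun n => (hKu n).trans (measure_mono (subset_iUnion K n))
  exact ⟨_, hm, (ae_eq_of_subset_of_measure_ge hsub hle hm.nullMeasurableSet
    (measure_ne_top _ _)).symm⟩

/-! ### Measurable sections and disintegrations along the fibres of a function -/

/-- The identity from the completed space to the original one pushes the completion to `ρ`. This is
needed because `quotientMeasure` is a push forward of the completion. -/
theorem lintegral_completion {Ω : Type*} [MeasurableSpace Ω] (ρ : Measure Ω) {φ : Ω → ℝ≥0∞}
    (hφ : AEMeasurable φ ρ) : ∫⁻ x : NullMeasurableSpace Ω ρ, φ x ∂ρ.completion = ∫⁻ x, φ x ∂ρ := by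
  obtain ⟨ψ, hψ, hφψ⟩ := hφ
  have hid : @Measurable (NullMeasurableSpace Ω ρ) Ω _ _ id := fun s hs => hs.nullMeasurableSet
  have hmap : @Measure.map (NullMeasurableSpace Ω ρ) Ω _ _ id ρ.completion = ρ := by
    ext s hs
    rw [Measure.map_apply hid hs]
    rfl
  have hc : ∫⁻ x : NullMeasurableSpace Ω ρ, φ x ∂ρ.completion
      = ∫⁻ x : NullMeasurableSpace Ω ρ, ψ x ∂ρ.completion :=
    lintegral_congr_ae hφψ
  rw [lintegral_congr_ae hφψ, hc]
  conv_rhs => rw [← hmap]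
  rw [lintegral_map hψ hid]
  rfl

theorem setLIntegral_quotientMeasure {Ω S : Type*} [MeasurableSpace Ω] (ρ : Measure Ω) (r : Ω → S)
    {φ : S → ℝ≥0∞} (hφ : NullMeasurable (φ ∘ r) ρ) {C : Set S} (hC : NullMeasurableSet (r ⁻¹' C) ρ) :
    ∫⁻ s in C, φ s ∂(quotientMeasure ρ r) = ∫⁻ x in r ⁻¹' C, φ (r x) ∂ρ := by
  let _ : MeasurableSpace S := quotientSpace ρ r
  have hr : @Measurable (NullMeasurableSpace Ω ρ) S _ _ r := fun s hs => hs
  have hφ' : AEMeasurable (φ ∘ r) ρ := hφ.aemeasurable_of_aerange (t := univ) (by simp)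
  have hCm : MeasurableSet C := hC
  have hφm : Measurable φ := hφ
  rw [quotientMeasure, ← lintegral_indicator hCm,
    lintegral_map (hφm.indicator hCm) hr, ← lintegral_indicator₀ hC]
  exact lintegral_completion ρ (hφ'.indicator₀ hC)

/-- The complement of the range of `i` is null for the image measure, so what is defined arbitrarily
outside the range does no harm. -/
theorem nullMeasurableSet_map_of_preimage {Ω Y : Type*} [MeasurableSpace Ω] [MeasurableSpace Y]
    {i : Y → Ω} (hi : MeasurableEmbedding i) {ρ : Measure Y} {D : Set Ω}
    (hD : NullMeasurableSet (i ⁻¹' D) ρ) : NullMeasurableSet D (ρ.map i) := by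
  obtain ⟨t, ht, hDt⟩ := hD
  refine ⟨i '' t, hi.measurableSet_image' ht, Filter.eventuallyEq_set.2 (hi.ae_map_iff.2 ?_)⟩
  filter_upwards [Filter.eventuallyEq_set.1 hDt] with y hy
  rw [hi.injective.mem_set_image]
  exact hy

/-- A null measurable set which is saturated for `h` is almost equal to the preimage of a Borel
set. -/
theorem exists_preimage_ae_eq_of_saturated {Y : Type*} [MeasurableSpace Y] [StandardBorelSpace Y]
    {ρ : Measure Y} {h : Y → ℝ} (hh : Measurable h) {A : Set Y} (hA : NullMeasurableSet A ρ)
    (hsat : ∀ y y', h y = h y' → y ∈ A → y' ∈ A) :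
    ∃ D, MeasurableSet D ∧ A =ᵐ[ρ] h ⁻¹' D := by
  obtain ⟨A₀, hA₀, hA₀m, hA₀e⟩ := hA.exists_measurable_subset_ae_eq
  obtain ⟨A₁, hA₁, hA₁m, hA₁e⟩ := hA.compl.exists_measurable_subset_ae_eq
  -- By saturation no value of `h` is taken both in `A` and in its complement, so the Lusin
  -- separation theorem applies to the two analytic images.
  have hd : Disjoint (h '' A₀) (h '' A₁) := by
    rw [disjoint_left]
    rintro _ ⟨y, hy, rfl⟩ ⟨y', hy', he⟩
    exact hA₁ hy' (hsat y y' he.symm (hA₀ hy))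
  obtain ⟨D, hD₀, hD₁, hD⟩ :=
    (hA₀m.analyticSet_image hh).measurablySeparable (hA₁m.analyticSet_image hh) hd
  refine ⟨D, hD, ?_⟩
  filter_upwards [hA₀e, hA₁e] with y h0 h1
  have h0 : y ∈ A₀ ↔ y ∈ A := iff_of_eq h0
  have h1 : y ∈ A₁ ↔ y ∉ A := iff_of_eq h1
  refine propext (?_ : y ∈ A ↔ h y ∈ D)
  refine ⟨fun hy => hD₀ (mem_image_of_mem h (h0.2 hy)), fun hy => ?_⟩
  by_contra hn
  exact disjoint_left.1 hD₁ (mem_image_of_mem h (h1.2 hn)) hy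

/-- The lowest point of the fibres of a compact plane set is a Borel function. -/
theorem exists_measurable_section_of_isCompact {K : Set (ℝ × ℝ)} (hK : IsCompact K) :
    ∃ m : ℝ → ℝ, Measurable m ∧ ∀ c ∈ Prod.snd '' K, (m c, c) ∈ K := by
  classical
  have hfib : ∀ c, IsCompact {a | (a, c) ∈ K} := fun c => by
    have : {a | (a, c) ∈ K} = Prod.fst '' (K ∩ Prod.snd ⁻¹' {c}) := by
      ext a; simp
    rw [this]
    exact (hK.inter_right (isClosed_singleton.preimage continuous_snd)).image continuous_fst
  have hmem : ∀ c ∈ Prod.snd '' K, (sInf {a | (a, c) ∈ K}, c) ∈ K := by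
    rintro c ⟨⟨a, c'⟩, ha, rfl⟩
    exact (hfib c').sInf_mem ⟨a, ha⟩
  have hP : MeasurableSet (Prod.snd '' K) := (hK.image continuous_snd).measurableSet
  refine ⟨(Prod.snd '' K).piecewise (fun c => sInf {a | (a, c) ∈ K}) (fun _ => 0), ?_, ?_⟩
  · refine measurable_of_Iic fun b => ?_
    rw [piecewise_preimage, Set.ite]
    refine MeasurableSet.union ?_ ((measurable_const measurableSet_Iic).diff hP)
    have : (fun c => sInf {a | (a, c) ∈ K}) ⁻¹' Iic b ∩ Prod.snd '' K
        = Prod.snd '' (K ∩ Prod.fst ⁻¹' Iic b) := by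
      ext c
      constructor
      · rintro ⟨h1, h2⟩
        exact ⟨_, ⟨hmem c h2, h1⟩, rfl⟩
      · rintro ⟨⟨a, c'⟩, ⟨h1, h2⟩, rfl⟩
        exact ⟨(csInf_le (hfib c').bddBelow h1).trans h2, _, h1, rfl⟩
    rw [this]
    exact ((hK.inter_right (isClosed_Iic.preimage continuous_fst)).image
      continuous_snd).measurableSet
  · intro c hc
    rw [piecewise_eq_of_mem _ _ _ hc]
    exact hmem c hc

/-- A Borel function on a standard Borel space with a finite measure has a Borel section over
a Borel set of full measure. -/
theorem exists_measurable_section {Y : Type*} [MeasurableSpace Y] [StandardBorelSpace Y]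
    [Nonempty Y] (ρ : Measure Y) [IsFiniteMeasure ρ] {h : Y → ℝ} (hh : Measurable h) :
    ∃ (P : Set ℝ) (s : ℝ → Y), MeasurableSet P ∧ Measurable s ∧ (∀ᵐ y ∂ρ, h y ∈ P) ∧
      ∀ c ∈ P, h (s c) = c := by
  classical
  -- The first coordinate makes `F` injective, and the second turns `h` into the projection of a
  -- Borel plane set, which compact sets exhaust up to a null set.
  let F : Y → ℝ × ℝ := fun y => (embeddingReal Y y, h y)
  have hFm : Measurable F := (measurableEmbedding_embeddingReal Y).measurable.prodMk hh
  have hF : MeasurableEmbedding F := hFm.measurableEmbedding fun x y hxy =>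
    (measurableEmbedding_embeddingReal Y).injective (Prod.ext_iff.1 hxy).1
  have hε : ∀ n : ℕ, ((n : ℝ≥0∞) + 1)⁻¹ ≠ 0 := fun n => by simp
  choose K hKF hK hKm using fun n => hF.measurableSet_range.exists_isCompact_sdiff_lt
    (measure_ne_top (ρ.map F) _) (hε n)
  choose m hm hmK using fun n => exists_measurable_section_of_isCompact (hK n)
  let P : Set ℝ := ⋃ n, Prod.snd '' K n
  have hPm : ∀ n, MeasurableSet (Prod.snd '' K n) := fun n =>
    ((hK n).image continuous_snd).measurableSet
  have hP : MeasurableSet P := MeasurableSet.iUnion hPm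
  -- The second alternative makes `Nat.find` total; over `P` it selects the first compact set whose
  -- projection contains `c`.
  have hex : ∀ c, ∃ n, c ∈ Prod.snd '' K n ∨ c ∉ P := fun c => by
    by_cases hc : c ∈ P
    · obtain ⟨n, hn⟩ := mem_iUnion.1 hc
      exact ⟨n, Or.inl hn⟩
    · exact ⟨0, Or.inr hc⟩
  let s : ℝ → Y := fun c => hF.invFun (m (Nat.find (hex c)) c, c)
  refine ⟨P, s, hP, ?_, ?_, ?_⟩
  · refine hF.measurable_invFun.comp (Measurable.prodMk ?_ measurable_id)
    exact Measurable.find (p := fun n c => c ∈ Prod.snd '' K n ∨ c ∉ P) hm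
      (fun n => (hPm n).union hP.compl) hex
  · have h0 : ρ.map F (range F \ ⋃ n, K n) = 0 := by
      refine le_antisymm (ENNReal.le_of_forall_pos_le_add fun ε hε _ => ?_) zero_le
      obtain ⟨n, hn⟩ := ENNReal.exists_inv_nat_lt (ENNReal.coe_pos.2 hε).ne'
      rw [zero_add]
      refine (measure_mono (sdiff_subset_sdiff_right (subset_iUnion K n))).trans
        ((hKm n).le.trans (le_trans ?_ hn.le))
      exact ENNReal.inv_le_inv.2 le_self_add
    rw [ae_iff]
    rw [hF.map_apply] at h0
    refine measure_mono_null (fun y hy => ?_) h0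
    refine ⟨mem_range_self y, fun hyK => hy ?_⟩
    obtain ⟨n, hn⟩ := mem_iUnion.1 hyK
    exact mem_iUnion.2 ⟨n, F y, hn, rfl⟩
  · intro c hc
    have hn := (Nat.find_spec (hex c)).resolve_right (not_not.2 hc)
    obtain ⟨y, hy⟩ := hKF _ (hmK _ c hn)
    have : s c = y := by
      change hF.invFun _ = y
      rw [← hy, hF.leftInverse_invFun]
    rw [this]
    exact congrArg Prod.snd hy

section

variable {Ω Y : Type*} [MeasurableSpace Ω] [MeasurableSpace Y] [StandardBorelSpace Y]
  {i : Y → Ω} {ρ : Measure Y} [IsFiniteMeasure ρ] {E : Ω → Ω → Prop} {g : Ω → ℝ}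

/-- The cross section of an equivalence relation whose classes are the fibres of a function. -/
theorem exists_isCrossSection (hi : MeasurableEmbedding i) (hg : Measurable (g ∘ i))
    (hgE : ∀ x y, g x = g y ↔ E x y) :
    ∃ f : Ω → Ω, NullMeasurable f (ρ.map i) ∧ IsCrossSection E f := by
  classical
  -- A representative obtained by choice, with no measurability: it serves only where `g` misses
  -- `P`, a null set, or when `Y` is empty.
  let out : Ω → Ω := fun x => (Quot.mk E x).out
  have hout : ∀ x, g (out x) = g x := fun x =>
    congrArg (Quot.lift g fun a b hab => (hgE a b).2 hab) (Quot.out_eq (Quot.mk E x))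
  have hout_eq : ∀ x y, E x y → out x = out y := fun x y hxy => by
    simp only [out, Quot.sound hxy]
  rcases isEmpty_or_nonempty Y with hY | hY
  · refine ⟨out, fun s _ => NullMeasurableSet.of_null ?_, fun x => (hgE _ _).1 (hout x).symm,
      hout_eq⟩
    rw [Measure.eq_zero_of_isEmpty ρ]; simp
  obtain ⟨P, s, hP, hs, hae, hsec⟩ := exists_measurable_section ρ hg
  refine ⟨fun x => if g x ∈ P then i (s (g x)) else out x, fun B hB => ?_, fun x => ?_,
    fun x y hxy => ?_⟩
  · refine nullMeasurableSet_map_of_preimage hi ?_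
    have hm : Measurable fun y => i (s (g (i y))) := hi.measurable.comp (hs.comp hg)
    refine (hm hB).nullMeasurableSet.congr ?_
    filter_upwards [hae] with y hy
    refine propext (?_ : i (s (g (i y))) ∈ B ↔ (if g (i y) ∈ P then _ else _) ∈ B)
    rw [if_pos (show g (i y) ∈ P from hy)]
  · refine (hgE _ _).1 ?_
    dsimp only
    split_ifs with hx
    · exact (hsec _ hx).symm
    · exact (hout x).symm
  · simp only [(hgE x y).2 hxy, hout_eq x y hxy]

open ProbabilityTheory in
/-- The strongly consistent disintegration along the classes of an equivalence relation which are
the fibres of a function. -/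
theorem exists_isStronglyConsistentDisintegration (hi : MeasurableEmbedding i)
    (hg : Measurable (g ∘ i)) (hgE : ∀ x y, g x = g y ↔ E x y) :
    ∃ κ : Quot E → Measure Ω,
      IsStronglyConsistentDisintegration (ρ.map i) (Quot.mk E) κ := by
  classical
  have hfib : ∀ x y, Quot.mk E x = Quot.mk E y ↔ g x = g y := fun x y => by
    refine ⟨fun h => ?_, fun h => Quot.sound ((hgE _ _).1 h)⟩
    have := congrArg (Quot.lift g fun a b hab => (hgE a b).2 hab) h
    exact this
  rcases isEmpty_or_nonempty Y with hY | hY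
  · have h0 : ρ.map i = 0 := by rw [Measure.eq_zero_of_isEmpty ρ]; simp
    refine ⟨fun s => Measure.dirac s.out, fun s => inferInstance, fun B _ C _ => ?_,
      fun B _ C hC => ?_, fun s => ?_⟩
    · refine NullMeasurableSet.of_null ?_
      rw [h0]; simp
    · rw [setLIntegral_quotientMeasure _ _ _ hC, h0]
      · simp
      · exact fun D _ => NullMeasurableSet.of_null (by rw [h0]; simp)
    · exact Measure.dirac_apply_of_mem (Quot.out_eq s)
  let G : Quot E → ℝ := Quot.lift g fun a b hab => (hgE a b).2 hab
  let k := condDistrib (id : Y → Y) (g ∘ i) ρ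
  -- The joint law of `g ∘ i` and the identity is carried by the graph, so almost every conditional
  -- law is carried by its fibre.
  have hk : ∀ᵐ c ∂ρ.map (g ∘ i), k c ((g ∘ i) ⁻¹' {c}) = 1 := by
    have h1 : ∀ᵐ p ∂((ρ.map (g ∘ i)) ⊗ₘ k), (g ∘ i) p.2 = p.1 := by
      rw [compProd_map_condDistrib measurable_id.aemeasurable,
        ae_map_iff (hg.prodMk measurable_id).aemeasurable
          (show MeasurableSet {p : ℝ × Y | (g ∘ i) p.2 = p.1} from
            measurableSet_eq_fun (hg.comp measurable_snd) measurable_fst)]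
      exact Filter.Eventually.of_forall fun y => rfl
    filter_upwards [Measure.ae_ae_of_ae_compProd h1] with c hc
    exact prob_compl_eq_zero_iff (hg (measurableSet_singleton c)) |>.1 hc
  obtain ⟨P, hPae, hP, hPk⟩ := hk.exists_measurable_mem
  have hae : ∀ᵐ y ∂ρ, g (i y) ∈ P := ae_of_ae_map hg.aemeasurable hPae
  -- The Dirac masses make strong consistency hold for every class, not merely almost every one.
  let κ : Quot E → Measure Ω := fun s => if G s ∈ P then (k (G s)).map i else Measure.dirac s.out
  have hκ : ∀ B : Set Ω, ∀ᵐ y ∂ρ, k (g (i y)) (i ⁻¹' B) = κ (Quot.mk E (i y)) B := fun B => by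
    filter_upwards [hae] with y hy
    have : κ (Quot.mk E (i y)) = (k (g (i y))).map i := if_pos hy
    rw [this, hi.map_apply]
  have hκm : ∀ B : Set Ω, MeasurableSet B →
      NullMeasurable ((fun s => κ s B) ∘ Quot.mk E) (ρ.map i) := fun B hB D hD => by
    refine nullMeasurableSet_map_of_preimage hi ?_
    have hm : Measurable fun y => k (g (i y)) (i ⁻¹' B) :=
      (Kernel.measurable_coe k (hi.measurable hB)).comp hg
    refine (hm hD).nullMeasurableSet.congr ?_
    filter_upwards [hκ B] with y hy
    exact propext (iff_of_eq (congrArg (· ∈ D) hy))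
  refine ⟨κ, fun s => ?_, hκm, fun B hB C hC => ?_, fun s => ?_⟩
  · by_cases hs : G s ∈ P
    · rw [show κ s = _ from if_pos hs]
      exact Measure.isProbabilityMeasure_map hi.measurable.aemeasurable
    · rw [show κ s = _ from if_neg hs]
      infer_instance
  · have hC' : NullMeasurableSet (Quot.mk E ⁻¹' C) (ρ.map i) := hC
    have hA : NullMeasurableSet (i ⁻¹' (Quot.mk E ⁻¹' C)) ρ :=
      hC'.preimage ⟨hi.measurable, Measure.AbsolutelyContinuous.rfl⟩
    -- The preimage of `C` is only null measurable, but it is a union of fibres; the defining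
    -- property of the conditional law requires a Borel set `D` of values.
    obtain ⟨D, hD, hAD⟩ := exists_preimage_ae_eq_of_saturated hg hA fun y y' hyy' hy => by
      have := (hfib (i y) (i y')).2 hyy'
      rw [mem_preimage, mem_preimage, ← this]; exact hy
    rw [setLIntegral_quotientMeasure _ _ (hκm B hB) hC, hi.map_apply, hi.restrict_map,
      hi.lintegral_map, preimage_inter, inter_comm, measure_congr (hAD.inter (ae_eq_refl (i ⁻¹' B))),
      Measure.restrict_congr_set hAD,
      ← lintegral_congr_ae (ae_restrict_of_ae (hκ B))]
    exact (setLIntegral_preimage_condDistrib hg measurable_id.aemeasurable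
      (hi.measurable hB) hD).symm
  · by_cases hs : G s ∈ P
    · rw [show κ s = _ from if_pos hs, hi.map_apply, ← hPk _ hs]
      congr 1
      induction s using Quot.ind with | _ x =>
      ext y
      exact hfib (i y) x
    · rw [show κ s = _ from if_neg hs]
      exact Measure.dirac_apply_of_mem (Quot.out_eq s)

end

variable {X : Type*}

/-! ### The real valued distance -/

/-- The distance `dL` as a real number, meaningful where `dL` is finite. -/
noncomputable def realDist (dL : X → X → ℝ≥0∞) (x y : X) : ℝ := (dL x y).toReal

theorem realDist_nonneg (dL : X → X → ℝ≥0∞) (x y : X) : 0 ≤ realDist dL x y :=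
  ENNReal.toReal_nonneg

theorem ofReal_realDist {dL : X → X → ℝ≥0∞} {x y : X} (h : dL x y ≠ ∞) :
    ENNReal.ofReal (realDist dL x y) = dL x y :=
  ENNReal.ofReal_toReal h

namespace IsExtendedDistance

variable {dL : X → X → ℝ≥0∞} (hd : IsExtendedDistance dL)

include hd

theorem self (x : X) : dL x x = 0 := (hd.eq_zero_iff x x).2 rfl

theorem ne_top_trans {x y z : X} (hxy : dL x y ≠ ∞) (hyz : dL y z ≠ ∞) : dL x z ≠ ∞ :=
  ne_top_of_le_ne_top (ENNReal.add_ne_top.2 ⟨hxy, hyz⟩) (hd.triangle x y z)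

theorem ne_top_symm {x y : X} (hxy : dL x y ≠ ∞) : dL y x ≠ ∞ := hd.symm x y ▸ hxy

theorem self_ne_top (x : X) : dL x x ≠ ∞ := by simp [hd.self]

theorem realDist_comm (x y : X) : realDist dL x y = realDist dL y x := by
  rw [realDist, hd.symm, realDist]

theorem realDist_self (x : X) : realDist dL x x = 0 := by simp [realDist, hd.self]

theorem realDist_triangle {x y z : X} (hxy : dL x y ≠ ∞) (hyz : dL y z ≠ ∞) :
    realDist dL x z ≤ realDist dL x y + realDist dL y z := by
  rw [realDist, realDist, realDist, ← ENNReal.toReal_add hxy hyz]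
  exact ENNReal.toReal_mono (ENNReal.add_ne_top.2 ⟨hxy, hyz⟩) (hd.triangle x y z)

theorem eq_of_realDist_eq_zero {x y : X} (hxy : dL x y ≠ ∞) (h : realDist dL x y = 0) : x = y := by
  rw [← hd.eq_zero_iff, ← ofReal_realDist hxy, h, ENNReal.ofReal_zero]

theorem realDist_pos {x y : X} (hxy : dL x y ≠ ∞) (h : x ≠ y) : 0 < realDist dL x y :=
  (realDist_nonneg dL x y).lt_of_ne' fun h0 => h (hd.eq_of_realDist_eq_zero hxy h0)

end IsExtendedDistance

/-! ### Chains of pairs -/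

/-- `Chain dL Γ w z c`: there are pairs `(w i, z i) ∈ Γ`, `0 ≤ i ≤ n`, with `w 0 = w`, `z n = z` and
`∑ i < n, dL (w (i + 1)) (z i) - ∑ i ≤ n, dL (w i) (z i) = c`. -/
inductive Chain (dL : X → X → ℝ≥0∞) (Γ : Set (X × X)) : X → X → ℝ → Prop
  | single {w z : X} (h : (w, z) ∈ Γ) : Chain dL Γ w z (-realDist dL w z)
  | cons {w z w' z' : X} {c : ℝ} (h : (w, z) ∈ Γ) (hf : dL w' z ≠ ∞) (hc : Chain dL Γ w' z' c) :
      Chain dL Γ w z' (c + realDist dL w' z - realDist dL w z)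

section Chain

variable {dL : X → X → ℝ≥0∞} {Γ : Set (X × X)}

theorem Chain.ne_top (hd : IsExtendedDistance dL) (hfin : ∀ p ∈ Γ, dL p.1 p.2 ≠ ∞) {w z : X}
    {c : ℝ} (h : Chain dL Γ w z c) : dL w z ≠ ∞ := by
  induction h with
  | single h => exact hfin _ h
  | cons h hf _ ih => exact hd.ne_top_trans (hfin _ h) (hd.ne_top_trans (hd.ne_top_symm hf) ih)

/-- The chain from `w'` comes first; its last point `z'` is linked to `w`, which adds the middle
term to the cost. -/
theorem Chain.append {w z w' z' : X} {c c' : ℝ} (h : Chain dL Γ w z c) (h' : Chain dL Γ w' z' c')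
    (hf : dL w z' ≠ ∞) : Chain dL Γ w' z (c + realDist dL w z' + c') := by
  induction h' with
  | single h' => simpa [sub_eq_add_neg] using Chain.cons h' hf h
  | cons h' hf' _ ih =>
    convert Chain.cons h' hf' (ih hf) using 1
    ring

theorem Chain.exists_fin {w z : X} {c : ℝ}
    (h : Chain dL Γ w z c) : ∃ (n : ℕ) (p : Fin (n + 1) → X × X), (∀ i, p i ∈ Γ) ∧ (p 0).1 = w ∧
      (p (Fin.last n)).2 = z ∧ (∀ i : Fin n, dL (p i.succ).1 (p i.castSucc).2 ≠ ∞) ∧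
      c = ∑ i : Fin n, realDist dL (p i.succ).1 (p i.castSucc).2
        - ∑ i, realDist dL (p i).1 (p i).2 := by
  induction h with
  | @single w z h =>
    exact ⟨0, fun _ => (w, z), fun _ => h, rfl, rfl, fun i => i.elim0, by simp⟩
  | @cons w z w' z' c h hf _ ih =>
    obtain ⟨n, p, hp, h0, hl, hff, hc⟩ := ih
    refine ⟨n + 1, Fin.cons (w, z) p, Fin.cases h hp, rfl, ?_, ?_, ?_⟩
    · rw [← hl, ← Fin.succ_last, Fin.cons_succ]
    · refine Fin.cases ?_ fun i => ?_
      · simpa [h0] using hf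
      · rw [← Fin.succ_castSucc, Fin.cons_succ, Fin.cons_succ]
        exact hff i
    · rw [Fin.sum_univ_succ, Fin.sum_univ_succ (n := n + 1), hc]
      simp only [← Fin.succ_castSucc, Fin.cons_succ, Fin.cons_zero, Fin.castSucc_zero, h0]
      ring

theorem Chain.of_fin {n : ℕ} {p : Fin (n + 1) → X × X} (hp : ∀ i, p i ∈ Γ)
    (hf : ∀ i : Fin n, dL (p i.succ).1 (p i.castSucc).2 ≠ ∞) :
    Chain dL Γ (p 0).1 (p (Fin.last n)).2 (∑ i : Fin n, realDist dL (p i.succ).1 (p i.castSucc).2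
      - ∑ i, realDist dL (p i).1 (p i).2) := by
  induction n with
  | zero => simpa using Chain.single (hp 0)
  | succ n ih =>
    have := Chain.cons (hp 0) (hf 0) (ih (p := fun i => p i.succ) (fun i => hp _) fun i => hf i.succ)
    convert this using 1
    · rw [Fin.succ_last]
    · rw [Fin.sum_univ_succ, Fin.sum_univ_succ (n := n + 1)]
      simp only [← Fin.succ_castSucc, Fin.castSucc_zero]
      ring

theorem sum_cyclic {n : ℕ} (p : Fin (n + 1) → X × X) :
    ∑ i, dL (p (i + 1)).1 (p i).2
      = ∑ i : Fin n, dL (p i.succ).1 (p i.castSucc).2 + dL (p 0).1 (p (Fin.last n)).2 := by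
  rw [Fin.sum_univ_castSucc]
  simp

theorem toReal_sum_realDist {ι : Type*} [Fintype ι] {a b : ι → X} (h : ∀ i, dL (a i) (b i) ≠ ∞) :
    (∑ i, dL (a i) (b i)).toReal = ∑ i, realDist dL (a i) (b i) :=
  ENNReal.toReal_sum fun i _ => h i

/-- Cyclical monotonicity: the closure of a chain has nonnegative cost. -/
theorem Chain.nonneg (hd : IsExtendedDistance dL) (hfin : ∀ p ∈ Γ, dL p.1 p.2 ≠ ∞)
    (hmon : CyclicallyMonotone dL Γ) {w z : X} {c : ℝ} (h : Chain dL Γ w z c) :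
    0 ≤ c + realDist dL w z := by
  have hwz := h.ne_top hd hfin
  obtain ⟨n, p, hp, h0, hl, hff, rfl⟩ := h.exists_fin
  have := hmon n p hp
  rw [sum_cyclic, h0, hl] at this
  have hs : ∑ i : Fin n, dL (p i.succ).1 (p i.castSucc).2 ≠ ∞ :=
    ENNReal.sum_ne_top.2 fun i _ => hff i
  have := ENNReal.toReal_mono (ENNReal.add_ne_top.2 ⟨hs, hwz⟩) this
  rw [ENNReal.toReal_add hs hwz, toReal_sum_realDist hff,
    toReal_sum_realDist fun i => hfin _ (hp i)] at this
  change _ ≤ _ + realDist dL w z at this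
  linarith

/-- Since `dL` is finite on `Γ`, the equality of sums forces every cross term to be finite and can
be read in `ℝ`. The cost of a chain omits only the closing term, which must then be its opposite. -/
theorem mem_cycleSet_iff (hd : IsExtendedDistance dL) (hfin : ∀ p ∈ Γ, dL p.1 p.2 ≠ ∞) {w z : X} :
    (w, z) ∈ cycleSet dL Γ ↔ Chain dL Γ w z (-realDist dL w z) := by
  constructor
  · rintro ⟨n, p, hp, h0, hl, hsum⟩
    have hsf : ∑ i, dL (p i).1 (p i).2 ≠ ∞ := ENNReal.sum_ne_top.2 fun i _ => hfin _ (hp i)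
    dsimp only at h0 hl
    rw [sum_cyclic, h0, hl] at hsum
    obtain ⟨hs, hwz⟩ := ENNReal.add_ne_top.1 (hsum ▸ hsf)
    have hff : ∀ i : Fin n, dL (p i.succ).1 (p i.castSucc).2 ≠ ∞ := fun i =>
      ENNReal.sum_ne_top.1 hs i (Finset.mem_univ i)
    have hr := congrArg ENNReal.toReal hsum
    rw [ENNReal.toReal_add hs hwz, toReal_sum_realDist hff,
      toReal_sum_realDist fun i => hfin _ (hp i)] at hr
    change _ + realDist dL w z = _ at hr
    have := Chain.of_fin hp hff
    rw [h0, hl] at this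
    convert this using 1
    linarith
  · intro h
    have hwz := h.ne_top hd hfin
    obtain ⟨n, p, hp, h0, hl, hff, hc⟩ := h.exists_fin
    have hs : ∑ i : Fin n, dL (p i.succ).1 (p i.castSucc).2 ≠ ∞ :=
      ENNReal.sum_ne_top.2 fun i _ => hff i
    have hsf : ∑ i, dL (p i).1 (p i).2 ≠ ∞ := ENNReal.sum_ne_top.2 fun i _ => hfin _ (hp i)
    refine ⟨n, p, hp, h0, hl, ?_⟩
    rw [sum_cyclic, h0, hl]
    rw [← ENNReal.toReal_eq_toReal_iff' (ENNReal.add_ne_top.2 ⟨hs, hwz⟩) hsf,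
      ENNReal.toReal_add hs hwz, toReal_sum_realDist hff,
      toReal_sum_realDist fun i => hfin _ (hp i)]
    change _ + realDist dL w z = _
    linarith

/-- `Reach dL Γ y x a`: the point `y` is connected to `x` through a chain, at total cost at most
`a`. -/
def Reach (dL : X → X → ℝ≥0∞) (Γ : Set (X × X)) (y x : X) (a : ℝ) : Prop :=
  ∃ w z c, Chain dL Γ w z c ∧ dL y z ≠ ∞ ∧ dL w x ≠ ∞ ∧
    realDist dL y z + c + realDist dL w x ≤ a

theorem Reach.trans (hd : IsExtendedDistance dL) {x y u : X} {a b : ℝ} (h : Reach dL Γ y x a)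
    (h' : Reach dL Γ x u b) : Reach dL Γ y u (a + b) := by
  obtain ⟨w, z, c, hc, h1, h2, h3⟩ := h
  obtain ⟨w', z', c', hc', h1', h2', h3'⟩ := h'
  refine ⟨w', z, _, hc.append hc' (hd.ne_top_trans h2 h1'), h1, h2', ?_⟩
  have := hd.realDist_triangle h2 h1'
  linarith

theorem Reach.extend (hd : IsExtendedDistance dL) {x y u : X} {a : ℝ} (h : Reach dL Γ y x a)
    (hxu : dL x u ≠ ∞) : Reach dL Γ y u (a + realDist dL x u) := by
  obtain ⟨w, z, c, hc, h1, h2, h3⟩ := h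
  refine ⟨w, z, c, hc, h1, hd.ne_top_trans h2 hxu, ?_⟩
  have := hd.realDist_triangle h2 hxu
  linarith

theorem Reach.prepend (hd : IsExtendedDistance dL) {x y v : X} {a : ℝ} (h : Reach dL Γ y x a)
    (hvy : dL v y ≠ ∞) : Reach dL Γ v x (realDist dL v y + a) := by
  obtain ⟨w, z, c, hc, h1, h2, h3⟩ := h
  refine ⟨w, z, c, hc, hd.ne_top_trans hvy h1, h2, ?_⟩
  have := hd.realDist_triangle hvy h1
  linarith

theorem Reach.ne_top (hd : IsExtendedDistance dL) (hfin : ∀ p ∈ Γ, dL p.1 p.2 ≠ ∞) {x y : X}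
    {a : ℝ} (h : Reach dL Γ y x a) : dL x y ≠ ∞ := by
  obtain ⟨w, z, c, hc, h1, h2, -⟩ := h
  exact hd.ne_top_trans (hd.ne_top_symm h2)
    (hd.ne_top_trans (hc.ne_top hd hfin) (hd.ne_top_symm h1))

/-- Going on from `x` to `y` closes the chain, and a closed chain has nonnegative cost. -/
theorem Reach.neg_le (hd : IsExtendedDistance dL) (hfin : ∀ p ∈ Γ, dL p.1 p.2 ≠ ∞)
    (hmon : CyclicallyMonotone dL Γ) {x y : X} {a : ℝ} (h : Reach dL Γ y x a) :
    -realDist dL x y ≤ a := by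
  have hxy := h.ne_top hd hfin
  obtain ⟨w, z, c, hc, h1, h2, h3⟩ := h
  have h4 := hc.nonneg hd hfin hmon
  have h5 := hd.realDist_triangle h2 (hd.ne_top_trans hxy h1)
  have h6 := hd.realDist_triangle hxy h1
  linarith

/-- When the bound of `Reach.neg_le` is attained, all inequalities in its proof are equalities: the
chain closes at cost zero, and `x`, `y` lie in this order between its end points. -/
theorem mem_orientedRays_iff (hd : IsExtendedDistance dL) (hfin : ∀ p ∈ Γ, dL p.1 p.2 ≠ ∞)
    (hmon : CyclicallyMonotone dL Γ) {x y : X} :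
    (x, y) ∈ orientedRays dL Γ ↔ Reach dL Γ y x (-realDist dL x y) := by
  constructor
  · rintro ⟨⟨w, z⟩, hwz, heq⟩
    rw [mem_cycleSet_iff hd hfin] at hwz
    dsimp only at heq
    have hf := hwz.ne_top hd hfin
    obtain ⟨hf1, hf2⟩ := ENNReal.add_ne_top.1 (heq ▸ hf)
    obtain ⟨hf3, hf4⟩ := ENNReal.add_ne_top.1 hf1
    have hr := congrArg ENNReal.toReal heq
    rw [ENNReal.toReal_add hf1 hf2, ENNReal.toReal_add hf3 hf4] at hr
    change realDist dL w x + realDist dL x y + realDist dL y z = realDist dL w z at hr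
    exact ⟨w, z, _, hwz, hf2, hf3, by linarith⟩
  · intro h
    have hxy := h.ne_top hd hfin
    obtain ⟨w, z, c, hc, h1, h2, h3⟩ := h
    have h4 := hc.nonneg hd hfin hmon
    have h5 := hd.realDist_triangle h2 (hd.ne_top_trans hxy h1)
    have h6 := hd.realDist_triangle hxy h1
    refine ⟨(w, z), (mem_cycleSet_iff hd hfin).2 ?_, ?_⟩
    · convert hc using 1
      linarith
    · have hf := hc.ne_top hd hfin
      have hf3 := ENNReal.add_ne_top.2 ⟨h2, hxy⟩
      dsimp only
      rw [← ENNReal.toReal_eq_toReal_iff' (ENNReal.add_ne_top.2 ⟨hf3, h1⟩) hf,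
        ENNReal.toReal_add hf3 h1, ENNReal.toReal_add h2 hxy]
      change realDist dL w x + realDist dL x y + realDist dL y z = realDist dL w z
      linarith

end Chain

/-! ### The order along the rays -/

/-- The properties of the relation `G` of oriented rays: a transitive relation along which `dL` is
finite and additive and which contains the segments between related points. -/
structure IsRayOrder (dL : X → X → ℝ≥0∞) (G : Set (X × X)) : Prop where
  ne_top : ∀ {x y}, (x, y) ∈ G → dL x y ≠ ∞
  trans : ∀ {x y z}, (x, y) ∈ G → (y, z) ∈ G → (x, z) ∈ G
  add : ∀ {x y z}, (x, y) ∈ G → (y, z) ∈ G → realDist dL x z = realDist dL x y + realDist dL y z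
  between : ∀ {x y u}, (x, y) ∈ G → dL x u ≠ ∞ →
    realDist dL x u + realDist dL u y = realDist dL x y → (x, u) ∈ G ∧ (u, y) ∈ G

/-- Concatenation bounds the cost from `z` to `x` by `-dL x y - dL y z`, while it is at least `-dL x
z`; with the triangle inequality all are equal. For an intermediate point, the chain is lengthened
at one end by the missing segment. -/
theorem isRayOrder_orientedRays {dL : X → X → ℝ≥0∞} {Γ : Set (X × X)}
    (hd : IsExtendedDistance dL) (hfin : ∀ p ∈ Γ, dL p.1 p.2 ≠ ∞)
    (hmon : CyclicallyMonotone dL Γ) : IsRayOrder dL (orientedRays dL Γ) := by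
  have hadd : ∀ {x y z}, (x, y) ∈ orientedRays dL Γ → (y, z) ∈ orientedRays dL Γ →
      (x, z) ∈ orientedRays dL Γ ∧ realDist dL x z = realDist dL x y + realDist dL y z := by
    intro x y z hxy hyz
    rw [mem_orientedRays_iff hd hfin hmon] at hxy hyz ⊢
    have hxz := hyz.trans hd hxy
    have h1 := hxz.neg_le hd hfin hmon
    have h2 := hd.realDist_triangle (hxy.ne_top hd hfin) (hyz.ne_top hd hfin)
    have h3 : realDist dL x z = realDist dL x y + realDist dL y z := by linarith
    refine ⟨?_, h3⟩
    convert hxz using 1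
    linarith
  refine ⟨fun hxy => ?_, fun h h' => (hadd h h').1, fun h h' => (hadd h h').2, ?_⟩
  · exact ((mem_orientedRays_iff hd hfin hmon).1 hxy).ne_top hd hfin
  · intro x y u hxy hxu hadd
    simp only [mem_orientedRays_iff hd hfin hmon] at hxy ⊢
    constructor
    · convert hxy.prepend hd (hd.ne_top_trans (hd.ne_top_symm hxu) (hxy.ne_top hd hfin)) using 1
      linarith
    · convert hxy.extend hd hxu using 1
      linarith

/-- In a geodesic space, there is a point at any given distance on the way from `x` to `y`. -/
theorem IsGeodesicSpace.exists_between {dL : X → X → ℝ≥0∞} (hgeo : IsGeodesicSpace dL) {x y : X}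
    (hxy : dL x y ≠ ∞) {t : ℝ} (h0 : 0 ≤ t) (ht : t ≤ realDist dL x y) :
    ∃ u, dL x u = ENNReal.ofReal t ∧ dL u y = ENNReal.ofReal (realDist dL x y - t) := by
  obtain ⟨γ, ⟨-, hγ⟩, rfl, hy⟩ := hgeo x y hxy
  have hI : (0 : ℝ) ∈ Icc 0 (dL (γ 0) y).toReal := ⟨le_rfl, ENNReal.toReal_nonneg⟩
  refine ⟨γ t, ?_, ?_⟩
  · rw [hγ 0 hI t ⟨h0, ht⟩, zero_sub, abs_neg, abs_of_nonneg h0]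
  · conv_lhs => rw [← hy]
    rw [hγ t ⟨h0, ht⟩ _ ⟨ENNReal.toReal_nonneg, le_rfl⟩, abs_sub_comm, abs_of_nonneg]
    · rfl
    · exact sub_nonneg.2 ht

/-- In a non-branching geodesic space, two geodesics with a common initial segment coincide. -/
theorem eq_of_nonBranching {dL : X → X → ℝ≥0∞} (hd : IsExtendedDistance dL)
    (hgeo : IsGeodesicSpace dL) (hbranch : IsNonBranching dL) {p y : X} {δ : ℝ} (hδ : 0 < δ)
    (hpy : dL p y = ENNReal.ofReal δ) {l : ℝ} (hl : 0 ≤ l) {u z : X}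
    (hyu : dL y u = ENNReal.ofReal l) (hyz : dL y z = ENNReal.ofReal l)
    (hpu : dL p u = ENNReal.ofReal (δ + l)) (hpz : dL p z = ENNReal.ofReal (δ + l)) : u = z := by
  -- Induction on the scale of `l / δ`. If `l ≤ δ`, both geodesics from `p` have a common midpoint
  -- before `y`. Otherwise their midpoints lie `(l - δ) / 2` beyond `y` and agree by induction.
  -- Non-branching at the midpoint concludes.
  have key : ∀ (n : ℕ) (l : ℝ), 0 ≤ l → l ≤ 2 ^ n * δ → ∀ u z : X,
      dL y u = ENNReal.ofReal l → dL y z = ENNReal.ofReal l →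
      dL p u = ENNReal.ofReal (δ + l) → dL p z = ENNReal.ofReal (δ + l) → u = z := by
    have tri : ∀ {a b c : X} {s t r : ℝ}, 0 ≤ s → 0 ≤ t → dL a b = ENNReal.ofReal s →
        dL b c = ENNReal.ofReal t → s + t = r → dL a c ≤ ENNReal.ofReal r := by
      intro a b c s t r hs ht h1 h2 h3
      rw [← h3, ENNReal.ofReal_add hs ht, ← h1, ← h2]
      exact hd.triangle a b c
    have low : ∀ {a b c : X} {s t : ℝ}, 0 ≤ s → 0 ≤ t → dL a c = ENNReal.ofReal (s + t) →
        dL a b ≤ ENNReal.ofReal s → dL b c ≤ ENNReal.ofReal t →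
        dL a b = ENNReal.ofReal s ∧ dL b c = ENNReal.ofReal t := by
      intro a b c s t hs ht h1 h2 h3
      have h4 := hd.triangle a b c
      rw [h1, ENNReal.ofReal_add hs ht] at h4
      constructor
      · refine le_antisymm h2 ?_
        refine ENNReal.le_of_add_le_add_right ENNReal.ofReal_ne_top (h4.trans ?_)
        gcongr
      · refine le_antisymm h3 ?_
        refine ENNReal.le_of_add_le_add_left ENNReal.ofReal_ne_top (h4.trans ?_)
        gcongr
    intro n
    induction n with
    | zero =>
      intro l hl hln u z hyu hyz hpu hpz
      rw [pow_zero, one_mul] at hln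
      have hr : realDist dL p y = δ := by rw [realDist, hpy, ENNReal.toReal_ofReal hδ.le]
      obtain ⟨m, hm1, hm2⟩ := hgeo.exists_between (x := p) (y := y) (by simp [hpy])
        (t := (δ + l) / 2) (by linarith) (by linarith)
      have hmid : ∀ v, dL y v = ENNReal.ofReal l → dL p v = ENNReal.ofReal (δ + l) →
          dL m v = ENNReal.ofReal ((δ + l) / 2) := fun v h1 h2 =>
        (low (by linarith) (by linarith) (by rw [h2]; ring_nf) hm1.le
          (tri (by linarith) hl hm2 h1 (by linarith))).2
      exact hbranch (δ + l) (by linarith) p m hm1 ⟨hpu, hmid u hyu hpu⟩ ⟨hpz, hmid z hyz hpz⟩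
    | succ n ih =>
      intro l hl hln u z hyu hyz hpu hpz
      rcases le_or_gt l δ with hlδ | hlδ
      · exact ih l hl (hlδ.trans (le_mul_of_one_le_left hδ.le (one_le_pow₀ one_le_two)))
          u z hyu hyz hpu hpz
      have hmid : ∀ v, dL y v = ENNReal.ofReal l → dL p v = ENNReal.ofReal (δ + l) →
          ∃ m, dL y m = ENNReal.ofReal ((l - δ) / 2) ∧ dL m v = ENNReal.ofReal ((δ + l) / 2) ∧
            dL p m = ENNReal.ofReal ((δ + l) / 2) := fun v h1 h2 => by
        have hr : realDist dL y v = l := by rw [realDist, h1, ENNReal.toReal_ofReal hl]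
        obtain ⟨m, hm1, hm2⟩ := hgeo.exists_between (x := y) (y := v) (by simp [h1])
          (t := (l - δ) / 2) (by linarith) (by linarith)
        have hm2' : dL m v = ENNReal.ofReal ((δ + l) / 2) := by
          rw [hm2, hr]; ring_nf
        refine ⟨m, hm1, hm2', ?_⟩
        exact (low (by linarith) (by linarith) (by rw [h2]; ring_nf)
          (tri hδ.le (by linarith) hpy hm1 (by linarith)) hm2'.le).1
      obtain ⟨m, hm1, hm2, hm3⟩ := hmid u hyu hpu
      obtain ⟨m', hm1', hm2', hm3'⟩ := hmid z hyz hpz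
      have hmm : m = m' := ih ((l - δ) / 2) (by linarith)
        (by rw [pow_succ] at hln; linarith) m m' hm1 hm1'
        (by rw [hm3]; ring_nf) (by rw [hm3']; ring_nf)
      subst hmm
      exact hbranch (δ + l) (by linarith) p m hm3 ⟨hpu, hm2⟩ ⟨hpz, hm2'⟩
  obtain ⟨n, hn⟩ := pow_unbounded_of_one_lt (l / δ) one_lt_two
  exact key n l hl ((div_lt_iff₀ hδ).1 hn).le u z hyu hyz hpu hpz

namespace IsRayOrder

variable {dL : X → X → ℝ≥0∞} {G : Set (X × X)}

theorem left_refl (hd : IsExtendedDistance dL) (hG : IsRayOrder dL G) {x y : X}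
    (h : (x, y) ∈ G) : (x, x) ∈ G :=
  (hG.between h (hd.self_ne_top x) (by rw [hd.realDist_self, zero_add])).1

/-- Reversing the orientation exchanges rays into a point with rays out of it, so that one
comparison suffices. -/
theorem swap (hd : IsExtendedDistance dL) (hG : IsRayOrder dL G) :
    IsRayOrder dL (Prod.swap ⁻¹' G) where
  ne_top h := hd.ne_top_symm (hG.ne_top h)
  trans h h' := hG.trans h' h
  add {x y z} h h' := by
    rw [hd.realDist_comm x z, hG.add h' h, hd.realDist_comm z y, hd.realDist_comm y x, add_comm]
  between {x y u} h hxu hadd := by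
    refine (hG.between (x := y) (y := x) (u := u) h ?_ ?_).symm
    · exact hd.ne_top_trans (hG.ne_top h) hxu
    · rw [hd.realDist_comm y u, hd.realDist_comm u x, hd.realDist_comm y x, ← hadd, add_comm]

/-- Two rays which meet at `y` and continue beyond it are comparable. -/
theorem comparable_of_left (hd : IsExtendedDistance dL) (hG : IsRayOrder dL G)
    (hgeo : IsGeodesicSpace dL) (hbranch : IsNonBranching dL) {x z y y' : X} (hyy' : y' ≠ y)
    (hy : (y, y') ∈ G) (hx : (x, y) ∈ G) (hz : (z, y) ∈ G) : (x, z) ∈ G ∨ (z, x) ∈ G := by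
  wlog hle : realDist dL z y ≤ realDist dL x y generalizing x z
  · exact (this hz hx (le_of_not_ge hle)).symm
  left
  obtain ⟨u, hu1, hu2⟩ := hgeo.exists_between (hG.ne_top hx)
    (t := realDist dL x y - realDist dL z y) (sub_nonneg.2 hle)
    (sub_le_self _ (realDist_nonneg dL z y))
  have hxu : realDist dL x u = realDist dL x y - realDist dL z y := by
    rw [realDist, hu1, ENNReal.toReal_ofReal (sub_nonneg.2 hle)]
  have huy : realDist dL u y = realDist dL z y := by
    rw [realDist, hu2, sub_sub_cancel, ENNReal.toReal_ofReal (realDist_nonneg dL z y)]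
  obtain ⟨hG1, hG2⟩ := hG.between hx (u := u) (by simp [hu1]) (by linarith)
  have hsym : ∀ {a b : X} {r : ℝ}, (a, b) ∈ G → realDist dL a b = r →
      dL b a = ENNReal.ofReal r := fun hab hr => by
    rw [hd.symm, ← hr, ofReal_realDist (hG.ne_top hab)]
  -- Seen from `y'`, both `u` and `z` continue the segment from `y'` to `y` by the same length.
  have huz : u = z := eq_of_nonBranching hd hgeo hbranch
    (hd.realDist_pos (hG.ne_top hy) hyy'.symm) (hsym hy rfl) (realDist_nonneg dL z y)
    (hsym hG2 huy) (hsym hz rfl) (hsym (hG.trans hG2 hy) (by rw [hG.add hG2 hy, huy, add_comm]))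
    (hsym (hG.trans hz hy) (by rw [hG.add hz hy, add_comm]))
  exact huz ▸ hG1

theorem comparable_of_right (hd : IsExtendedDistance dL) (hG : IsRayOrder dL G)
    (hgeo : IsGeodesicSpace dL) (hbranch : IsNonBranching dL) {x z y y' : X} (hyy' : y' ≠ y)
    (hy : (y', y) ∈ G) (hx : (y, x) ∈ G) (hz : (y, z) ∈ G) : (x, z) ∈ G ∨ (z, x) ∈ G :=
  ((hG.swap hd).comparable_of_left hd hgeo hbranch hyy' hy hx hz).symm

end IsRayOrder

/-! ### Equivalence relations separated by countably many universally measurable sets -/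

/-- Null measurability of `T` is what keeps `Measure.comap` from taking its default value zero. -/
theorem comap_coe_apply {X : Type*} [MeasurableSpace X] {μ : Measure X} {T : Set X}
    (hT : NullMeasurableSet T μ) {B : Set X} (hB : MeasurableSet B) :
    μ.comap ((↑) : T → X) ((↑) ⁻¹' B) = μ (B ∩ T) := by
  rw [Measure.comap_preimage _ _ Subtype.val_injective measurable_subtype_coe _ hB,
    Subtype.range_coe]
  rintro _ ⟨t, ht, rfl⟩
  rw [Subtype.image_preimage_coe]
  exact hT.inter ht.nullMeasurableSet

/-- If countably many null measurable sets separate the classes of an equivalence relation on a set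
`T`, then it has a cross section and a strongly consistent disintegration. -/
theorem exists_crossSection_and_disintegration {X : Type*} [MeasurableSpace X]
    [StandardBorelSpace X] (μ : Measure X) [IsFiniteMeasure μ] {T : Set X}
    (hT : NullMeasurableSet T μ) {ι : Type*} [Countable ι] {A : ι → Set X}
    (hA : ∀ n, NullMeasurableSet (A n) μ) {E : T → T → Prop}
    (hE : ∀ x y : T, E x y ↔ ∀ n, ((x : X) ∈ A n ↔ (y : X) ∈ A n)) :
    (∃ f : T → T, NullMeasurable f (μ.comap ((↑) : T → X)) ∧ IsCrossSection E f) ∧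
    (∃ κ : Quot E → Measure T,
      IsStronglyConsistentDisintegration (μ.comap ((↑) : T → X)) (Quot.mk E) κ) := by
  classical
  obtain ⟨T₀, hT₀, hT₀m, hT₀e⟩ := hT.exists_measurable_subset_ae_eq
  choose A' hA' hAA' using hA
  have hae : ∀ᵐ x ∂μ, (x ∈ T₀ ↔ x ∈ T) ∧ ∀ n, (x ∈ A n ↔ x ∈ A' n) := by
    filter_upwards [Filter.eventuallyEq_set.1 hT₀e,
      ae_all_iff.2 fun n => Filter.eventuallyEq_set.1 (hAA' n)] with x h1 h2 using ⟨h1, h2⟩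
  -- On the Borel set `V` of full measure, `T` and all the `A n` coincide with Borel sets; `V ∩ T₀`
  -- is then a standard Borel space carrying the whole measure.
  obtain ⟨V, hVae, hV, hVA⟩ := hae.exists_measurable_mem
  let Y : Set X := V ∩ T₀
  have hY : MeasurableSet Y := hV.inter hT₀m
  have hYT : Y ⊆ T := inter_subset_right.trans hT₀
  have : StandardBorelSpace Y := hY.standardBorel
  let i : Y → T := inclusion hYT
  have him : Measurable i := measurable_inclusion hYT
  have hi : MeasurableEmbedding i := by
    refine ⟨inclusion_injective hYT, him, fun {s} hs => ?_⟩
    refine ⟨(↑) '' s, hY.subtype_image hs, ?_⟩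
    ext x
    constructor
    · rintro ⟨y, hy, hyx⟩
      exact ⟨y, hy, Subtype.ext hyx⟩
    · rintro ⟨y, hy, rfl⟩
      exact ⟨y, hy, rfl⟩
  have hρ : (μ.comap ((↑) : Y → X)).map i = μ.comap ((↑) : T → X) := by
    ext B hB
    obtain ⟨B', hB', rfl⟩ := hB
    rw [Measure.map_apply him (measurable_subtype_coe hB'), comap_coe_apply hT hB',
      ← preimage_comp]
    refine (comap_coe_apply hY.nullMeasurableSet hB').trans (measure_congr ?_)
    refine (ae_eq_refl B').inter (Filter.eventuallyEq_set.2 ?_)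
    filter_upwards [hVae] with x hx
    exact ⟨fun h => hYT h, fun h => ⟨hx, ((hVA x hx).1).2 h⟩⟩
  have hρf : IsFiniteMeasure (μ.comap ((↑) : Y → X)) := by
    refine ⟨?_⟩
    rw [← preimage_univ, comap_coe_apply hY.nullMeasurableSet MeasurableSet.univ]
    exact measure_lt_top _ _
  let F : X → ι → Bool := fun x n => decide (x ∈ A n)
  -- The fibres of `g` are the classes on all of `T`, whereas its Borel measurability is only
  -- obtained on `Y`.
  let g : T → ℝ := fun x => embeddingReal (ι → Bool) (F x)
  have hemb := measurableEmbedding_embeddingReal (ι → Bool)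
  have hg : Measurable (g ∘ i) := by
    refine hemb.measurable.comp (measurable_pi_iff.2 fun n => ?_)
    have hn : Measurable fun y : Y => decide ((y : X) ∈ A' n) :=
      (measurable_to_bool (by
        convert measurable_subtype_coe (hA' n) using 1
        ext y; simp))
    convert hn using 2 with y
    exact decide_eq_decide.2 ((hVA y y.2.1).2 n)
  have hgE : ∀ x y, g x = g y ↔ E x y := fun x y => by
    rw [hE, hemb.injective.eq_iff, funext_iff]
    exact forall_congr' fun n => decide_eq_decide
  rw [← hρ]
  exact ⟨exists_isCrossSection hi hg hgE, exists_isStronglyConsistentDisintegration hi hg hgE⟩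

/-! ### Analyticity of the rays -/

theorem analyticSet_inter {α : Type*} [TopologicalSpace α] [T2Space α] {s t : Set α}
    (hs : AnalyticSet s) (ht : AnalyticSet t) : AnalyticSet (s ∩ t) := by
  rw [inter_eq_iInter]
  exact AnalyticSet.iInter fun b => by cases b <;> assumption

theorem analyticSet_union {α : Type*} [TopologicalSpace α] {s t : Set α}
    (hs : AnalyticSet s) (ht : AnalyticSet t) : AnalyticSet (s ∪ t) := by
  rw [union_eq_iUnion]
  exact AnalyticSet.iUnion fun b => by cases b <;> assumption

theorem analyticSet_rays [TopologicalSpace X] [PolishSpace X] {dL : X → X → ℝ≥0∞}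
    {Γ : Set (X × X)} (hG : AnalyticSet (orientedRays dL Γ)) : AnalyticSet (rays dL Γ) :=
  analyticSet_union hG (hG.preimage continuous_swap)

section Analytic

variable [TopologicalSpace X] [PolishSpace X] [MeasurableSpace X] [BorelSpace X]
  {dL : X → X → ℝ≥0∞} {Γ : Set (X × X)}

theorem analyticSet_cycleSet (hBorel : Measurable fun p : X × X => dL p.1 p.2)
    (hΓ : MeasurableSet Γ) : AnalyticSet (cycleSet dL Γ) := by
  have : cycleSet dL Γ = ⋃ n : ℕ, (fun p : Fin (n + 1) → X × X => ((p 0).1, (p (Fin.last n)).2)) ''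
      ({p | ∀ i, p i ∈ Γ} ∩ {p | ∑ i, dL (p (i + 1)).1 (p i).2 = ∑ i, dL (p i).1 (p i).2}) := by
    ext ⟨x, y⟩
    rw [mem_iUnion]
    refine exists_congr fun n => exists_congr fun p => ?_
    constructor
    · rintro ⟨h1, h2, h3, h4⟩
      exact ⟨⟨h1, h4⟩, Prod.ext h2 h3⟩
    · rintro ⟨⟨h1, h4⟩, h⟩
      exact ⟨h1, (Prod.ext_iff.1 h).1, (Prod.ext_iff.1 h).2, h4⟩
  rw [this]
  refine AnalyticSet.iUnion fun n => AnalyticSet.image_of_continuous (MeasurableSet.analyticSet ?_)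
    (by fun_prop)
  refine MeasurableSet.inter ?_ (measurableSet_eq_fun ?_ ?_)
  · simp only [ofPred_forall]
    exact MeasurableSet.iInter fun i => measurable_pi_apply i hΓ
  · exact Finset.measurable_sum _ fun i _ => hBorel.comp
      (f := fun p : Fin (n + 1) → X × X => ((p (i + 1)).1, (p i).2)) (by fun_prop)
  · exact Finset.measurable_sum _ fun i _ => hBorel.comp (measurable_pi_apply i)

theorem analyticSet_orientedRays (hBorel : Measurable fun p : X × X => dL p.1 p.2)
    (hΓ : MeasurableSet Γ) : AnalyticSet (orientedRays dL Γ) := by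
  have : orientedRays dL Γ = Prod.snd '' ((Prod.fst ⁻¹' cycleSet dL Γ) ∩ {z : (X × X) × X × X |
      dL z.1.1 z.2.1 + dL z.2.1 z.2.2 + dL z.2.2 z.1.2 = dL z.1.1 z.1.2}) := by
    ext q
    constructor
    · rintro ⟨p, hp, h⟩
      exact ⟨(p, q), ⟨hp, h⟩, rfl⟩
    · rintro ⟨⟨p, q⟩, ⟨hp, h⟩, rfl⟩
      exact ⟨p, hp, h⟩
  rw [this]
  refine AnalyticSet.image_of_continuous (analyticSet_inter
    ((analyticSet_cycleSet hBorel hΓ).preimage continuous_fst) (MeasurableSet.analyticSet ?_))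
    continuous_snd
  have h1 : Measurable fun z : (X × X) × X × X => dL z.1.1 z.2.1 :=
    hBorel.comp (f := fun z : (X × X) × X × X => (z.1.1, z.2.1)) (by fun_prop)
  have h2 : Measurable fun z : (X × X) × X × X => dL z.2.1 z.2.2 := hBorel.comp measurable_snd
  have h3 : Measurable fun z : (X × X) × X × X => dL z.2.2 z.1.2 :=
    hBorel.comp (f := fun z : (X × X) × X × X => (z.2.2, z.1.2)) (by fun_prop)
  exact measurableSet_eq_fun ((h1.add h2).add h3) (hBorel.comp measurable_fst)

theorem analyticSet_transportSet (hG : AnalyticSet (orientedRays dL Γ)) :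
    AnalyticSet (transportSet dL Γ) := by
  have hne : AnalyticSet (orientedRays dL Γ ∩ {p | p.1 ≠ p.2}) :=
    analyticSet_inter hG (MeasurableSet.analyticSet
      (measurableSet_eq_fun measurable_fst measurable_snd).compl)
  have : transportSet dL Γ = (Prod.snd '' (orientedRays dL Γ ∩ {p | p.1 ≠ p.2})) ∩
      (Prod.fst '' (orientedRays dL Γ ∩ {p | p.1 ≠ p.2})) := by
    ext x
    constructor
    · rintro ⟨⟨w, hw, hwx⟩, z, hz, hxz⟩
      exact ⟨⟨(w, x), ⟨hwx, hw⟩, rfl⟩, (x, z), ⟨hxz, hz.symm⟩, rfl⟩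
    · rintro ⟨⟨⟨w, x⟩, ⟨hwx, hw⟩, rfl⟩, ⟨x, z⟩, ⟨hxz, hz⟩, rfl⟩
      exact ⟨⟨w, hw, hwx⟩, z, Ne.symm hz, hxz⟩
  rw [this]
  exact analyticSet_inter (hne.image_of_continuous continuous_snd)
    (hne.image_of_continuous continuous_fst)

end Analytic

/-! ### The transport rays -/

/-- The transport ray of `x`, without its end points. -/
def rayOf (dL : X → X → ℝ≥0∞) (Γ : Set (X × X)) (x : X) : Set X :=
  {y | y ∈ transportSet dL Γ ∧ (x, y) ∈ rays dL Γ}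

theorem analyticSet_saturation [TopologicalSpace X] [PolishSpace X] [MeasurableSpace X]
    [BorelSpace X] {dL : X → X → ℝ≥0∞} {Γ : Set (X × X)} (hG : AnalyticSet (orientedRays dL Γ))
    {U : Set X} (hU : IsOpen U) : AnalyticSet {x | (rayOf dL Γ x ∩ U).Nonempty} := by
  have : {x | (rayOf dL Γ x ∩ U).Nonempty}
      = Prod.fst '' (rays dL Γ ∩ Prod.snd ⁻¹' (transportSet dL Γ ∩ U)) := by
    ext x
    constructor
    · rintro ⟨y, ⟨hy, hxy⟩, hyU⟩
      exact ⟨(x, y), ⟨hxy, hy, hyU⟩, rfl⟩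
    · rintro ⟨⟨x, y⟩, ⟨hxy, hy, hyU⟩, rfl⟩
      exact ⟨y, ⟨hy, hxy⟩, hyU⟩
  rw [this]
  exact (analyticSet_inter (analyticSet_rays hG) ((analyticSet_inter
    (analyticSet_transportSet hG) hU.measurableSet.analyticSet).preimage
      continuous_snd)).image_of_continuous continuous_fst

section Rays

variable {dL : X → X → ℝ≥0∞} {Γ : Set (X × X)}

theorem rays_symm {x y : X} (h : (x, y) ∈ rays dL Γ) : (y, x) ∈ rays dL Γ := Or.symm h

/-- Only opposite orientations need non-branching: two rays enter or leave `y`, and since `y` is not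
an end point, some ray continues on its other side. -/
theorem rays_trans (hd : IsExtendedDistance dL) (hG : IsRayOrder dL (orientedRays dL Γ))
    (hgeo : IsGeodesicSpace dL) (hbranch : IsNonBranching dL) {x y z : X}
    (hy : y ∈ transportSet dL Γ) (hxy : (x, y) ∈ rays dL Γ) (hyz : (y, z) ∈ rays dL Γ) :
    (x, z) ∈ rays dL Γ := by
  obtain ⟨⟨w, hwy, hw⟩, ⟨v, hvy, hv⟩⟩ := hy
  rcases hxy with hxy | hyx <;> rcases hyz with hyz | hzy
  · exact Or.inl (hG.trans hxy hyz)
  · exact hG.comparable_of_left hd hgeo hbranch hvy hv hxy hzy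
  · exact hG.comparable_of_right hd hgeo hbranch hwy hw hyx hyz
  · exact Or.inr (hG.trans hzy hyx)

theorem equivalence_rayRel (hd : IsExtendedDistance dL) (hG : IsRayOrder dL (orientedRays dL Γ))
    (hgeo : IsGeodesicSpace dL) (hbranch : IsNonBranching dL) : Equivalence (rayRel dL Γ) where
  refl x := by
    obtain ⟨z, -, hz⟩ := x.2.2
    exact Or.inl (hG.left_refl hd hz)
  symm h := rays_symm h
  trans {_ y _} hxy hyz := rays_trans hd hG hgeo hbranch y.2 hxy hyz

open Classical in
/-- The signed distance from `x` along its ray. -/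
noncomputable def rayCoord (dL : X → X → ℝ≥0∞) (Γ : Set (X × X)) (x y : X) : ℝ :=
  if (x, y) ∈ orientedRays dL Γ then realDist dL x y else -realDist dL x y

theorem rayCoord_add (hd : IsExtendedDistance dL) (hG : IsRayOrder dL (orientedRays dL Γ))
    {x y y' : X} (hy : (x, y) ∈ rays dL Γ) (hy' : (x, y') ∈ rays dL Γ)
    (hyy' : (y, y') ∈ orientedRays dL Γ) :
    rayCoord dL Γ x y' = rayCoord dL Γ x y + realDist dL y y' := by
  by_cases h : (x, y) ∈ orientedRays dL Γ
  · rw [rayCoord, rayCoord, if_pos h, if_pos (hG.trans h hyy'), hG.add h hyy']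
  · have hyx : (y, x) ∈ orientedRays dL Γ := hy.resolve_left h
    rw [rayCoord, rayCoord, if_neg h]
    by_cases h' : (x, y') ∈ orientedRays dL Γ
    · rw [if_pos h', hG.add hyx h', hd.realDist_comm x y]
      ring
    · rw [if_neg h', hd.realDist_comm x y, hG.add hyy' (hy'.resolve_left h'),
        hd.realDist_comm x y']
      ring

/-- Each transport ray is the image of a geodesic. -/
theorem exists_isGeodesic_rayOf (hd : IsExtendedDistance dL)
    (hG : IsRayOrder dL (orientedRays dL Γ)) (hgeo : IsGeodesicSpace dL)
    (hbranch : IsNonBranching dL) {x : X} (hx : x ∈ transportSet dL Γ) :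
    ∃ (I : Set ℝ) (γ : ℝ → X), IsGeodesic dL I γ ∧ γ '' I = rayOf dL Γ x := by
  classical
  have hcomp : ∀ y ∈ rayOf dL Γ x, ∀ y' ∈ rayOf dL Γ x, (y, y') ∈ rays dL Γ :=
    fun y hy y' hy' => rays_trans hd hG hgeo hbranch hx (rays_symm hy.2) hy'.2
  have hdist : ∀ y ∈ rayOf dL Γ x, ∀ y' ∈ rayOf dL Γ x,
      dL y y' = ENNReal.ofReal |rayCoord dL Γ x y - rayCoord dL Γ x y'| := by
    have aux : ∀ y ∈ rayOf dL Γ x, ∀ y' ∈ rayOf dL Γ x, (y, y') ∈ orientedRays dL Γ →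
        dL y y' = ENNReal.ofReal |rayCoord dL Γ x y - rayCoord dL Γ x y'| := by
      intro y hy y' hy' h
      rw [rayCoord_add hd hG hy.2 hy'.2 h, sub_add_cancel_left, abs_neg,
        abs_of_nonneg (realDist_nonneg dL y y'), ofReal_realDist (hG.ne_top h)]
    intro y hy y' hy'
    rcases hcomp y hy y' hy' with h | h
    · exact aux y hy y' hy' h
    · rw [hd.symm, abs_sub_comm]
      exact aux y' hy' y hy h
  have hinj : InjOn (rayCoord dL Γ x) (rayOf dL Γ x) := fun y hy y' hy' h => by
    rw [← hd.eq_zero_iff, hdist y hy y' hy', h]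
    simp
  have : Nonempty X := ⟨x⟩
  refine ⟨rayCoord dL Γ x '' rayOf dL Γ x, Function.invFunOn (rayCoord dL Γ x) (rayOf dL Γ x),
    ⟨?_, ?_⟩, ?_⟩
  · refine ordConnected_of_Ioo ?_
    rintro _ ⟨y, hy, rfl⟩ _ ⟨y', hy', rfl⟩ - s ⟨hs, hs'⟩
    have hyy' : (y, y') ∈ orientedRays dL Γ := by
      refine (hcomp y hy y' hy').resolve_right fun h => ?_
      have := rayCoord_add hd hG hy'.2 hy.2 h
      have := realDist_nonneg dL y' y
      linarith
    have hadd := rayCoord_add hd hG hy.2 hy'.2 hyy'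
    obtain ⟨u, hu1, hu2⟩ := hgeo.exists_between (hG.ne_top hyy') (t := s - rayCoord dL Γ x y)
      (by linarith) (by linarith)
    have hr1 : realDist dL y u = s - rayCoord dL Γ x y := by
      rw [realDist, hu1, ENNReal.toReal_ofReal (by linarith)]
    have hr2 : realDist dL u y' = realDist dL y y' - (s - rayCoord dL Γ x y) := by
      rw [realDist, hu2, ENNReal.toReal_ofReal (by linarith)]
    obtain ⟨h1, h2⟩ := hG.between hyy' (u := u) (by simp [hu1]) (by linarith)
    -- Being strictly between `y` and `y'`, the point `u` is not an end point of the ray.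
    have hyu : y ≠ u := by
      rintro rfl
      rw [hd.realDist_self] at hr1
      linarith
    have huy' : y' ≠ u := by
      rintro rfl
      rw [hd.realDist_self] at hr2
      linarith
    have hxu : (x, u) ∈ rays dL Γ := rays_trans hd hG hgeo hbranch hy.1 hy.2 (Or.inl h1)
    refine ⟨u, ⟨⟨⟨y, hyu, h1⟩, y', huy', h2⟩, hxu⟩, ?_⟩
    rw [rayCoord_add hd hG hy.2 hxu h1, hr1]
    ring
  · rintro _ ⟨y, hy, rfl⟩ _ ⟨y', hy', rfl⟩
    rw [hinj.leftInvOn_invFunOn hy, hinj.leftInvOn_invFunOn hy', hdist y hy y' hy']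
  · exact hinj.leftInvOn_invFunOn.image_image

/-- Transport rays are locally closed for the metric of `X`. -/
theorem exists_isClosed_rayOf_inter_closedBall [MetricSpace X] (hd : IsExtendedDistance dL)
    (hG : IsRayOrder dL (orientedRays dL Γ)) (hgeo : IsGeodesicSpace dL)
    (hbranch : IsNonBranching dL) (hcont : GeodesicsContinuous dL)
    (hloc : GeodesicsLocallyCompact dL) {x y : X} (hx : x ∈ transportSet dL Γ)
    (hy : y ∈ rayOf dL Γ x) :
    ∃ r : ℝ, 0 < r ∧ IsClosed (rayOf dL Γ x ∩ Metric.closedBall y r) := by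
  obtain ⟨I, γ, hγ, hI⟩ := exists_isGeodesic_rayOf hd hG hgeo hbranch hx
  rw [← hI] at hy ⊢
  obtain ⟨t, ht, rfl⟩ := hy
  obtain ⟨r, hr, hK⟩ := hloc I γ hγ t ht
  refine ⟨r, hr, ?_⟩
  rw [← image_inter_preimage]
  exact (hK.image_of_continuousOn ((hcont I γ hγ).mono inter_subset_left)).isClosed

/-- Two points are on the same transport ray if their rays meet the same open sets of a basis. -/
theorem mem_rays_iff_forall_basis [MetricSpace X] (hd : IsExtendedDistance dL)
    (hG : IsRayOrder dL (orientedRays dL Γ)) (hgeo : IsGeodesicSpace dL)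
    (hbranch : IsNonBranching dL) (hcont : GeodesicsContinuous dL)
    (hloc : GeodesicsLocallyCompact dL) {b : Set (Set X)}
    (hb : TopologicalSpace.IsTopologicalBasis b) {x y : X} (hx : x ∈ transportSet dL Γ)
    (hy : y ∈ transportSet dL Γ) :
    (x, y) ∈ rays dL Γ ↔
      ∀ U : b, (rayOf dL Γ x ∩ U).Nonempty ↔ (rayOf dL Γ y ∩ U).Nonempty := by
  have hself : ∀ {x}, x ∈ transportSet dL Γ → x ∈ rayOf dL Γ x := fun {x} hx =>
    ⟨hx, (equivalence_rayRel hd hG hgeo hbranch).refl ⟨x, hx⟩⟩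
  constructor
  · intro hxy U
    have : rayOf dL Γ x = rayOf dL Γ y := by
      ext z
      exact and_congr_right fun _ => ⟨rays_trans hd hG hgeo hbranch hx (rays_symm hxy),
        rays_trans hd hG hgeo hbranch hy hxy⟩
    rw [this]
  · intro h
    obtain ⟨r, hr, hcl⟩ := exists_isClosed_rayOf_inter_closedBall hd hG hgeo hbranch hcont hloc hx
      (hself hx)
    have hxb : x ∈ Metric.ball x r := Metric.mem_ball_self hr
    obtain ⟨U, hU, hxU, hUV⟩ := hb.exists_subset_of_mem_open hxb Metric.isOpen_ball
    obtain ⟨z, hzy, hzU⟩ := (h ⟨U, hU⟩).1 ⟨x, hself hx, hxU⟩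
    have hzb : z ∈ Metric.ball x r := hUV hzU
    -- Basis sets around `z` meet the ray of `y`, hence that of `x`; so `z` is a limit of the ray of
    -- `x` inside a ball where this ray is closed, and the two rays share `z`.
    have hzx : z ∈ rayOf dL Γ x ∩ Metric.closedBall x r := by
      rw [← hcl.closure_eq, mem_closure_iff]
      intro V hV hzV
      obtain ⟨U, hU, hzU, hUV⟩ := hb.exists_subset_of_mem_open (show z ∈ V ∩ Metric.ball x r from
        ⟨hzV, hzb⟩) (hV.inter Metric.isOpen_ball)
      obtain ⟨v, hvx, hvU⟩ := (h ⟨U, hU⟩).2 ⟨z, hzy, hzU⟩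
      exact ⟨v, (hUV hvU).1, hvx, Metric.ball_subset_closedBall (hUV hvU).2⟩
    exact rays_trans hd hG hgeo hbranch hzy.1 hzx.1.2 (rays_symm hzy.2)

end Rays

end RayMonge

open RayMonge in
theorem propositionP {X : Type*} [MetricSpace X] [PolishSpace X] [MeasurableSpace X] [BorelSpace X]
    (dL : X → X → ℝ≥0∞) (hdist : IsExtendedDistance dL)
    (hBorel : Measurable fun p : X × X => dL p.1 p.2)
    (hgeo : IsGeodesicSpace dL) (hbranch : IsNonBranching dL)
    (hcont : GeodesicsContinuous dL) (hloc : GeodesicsLocallyCompact dL)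
    (μ ν : Measure X) [IsProbabilityMeasure μ] [IsProbabilityMeasure ν]
    (π : Measure (X × X)) (hplan : IsTransferencePlan μ ν π)
    (hcost : ∫⁻ p, dL p.1 p.2 ∂π < ∞)
    (Γ : Set (X × X)) (hcarrier : IsCarrier dL π Γ) :
    Equivalence (rayRel dL Γ) ∧
    NullMeasurableSet (transportSet dL Γ) μ ∧
    (∃ f : transportSet dL Γ → transportSet dL Γ,
      NullMeasurable f (μ.comap ((↑) : transportSet dL Γ → X)) ∧
      IsCrossSection (rayRel dL Γ) f) ∧
    (∃ κ : Quot (rayRel dL Γ) → Measure (transportSet dL Γ),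
      IsStronglyConsistentDisintegration (μ.comap ((↑) : transportSet dL Γ → X))
        (Quot.mk (rayRel dL Γ)) κ) := by
  have hΓ : MeasurableSet Γ := by
    obtain ⟨Γn, -, rfl, hΓn⟩ := hcarrier.exhaustion
    exact MeasurableSet.iUnion fun n => (hΓn n).1.measurableSet
  have hG := isRayOrder_orientedRays hdist hcarrier.finite hcarrier.cyclicallyMonotone
  have hGa := analyticSet_orientedRays hBorel hΓ
  have hT : NullMeasurableSet (transportSet dL Γ) μ :=
    nullMeasurableSet_of_analyticSet μ (analyticSet_transportSet hGa)
  have hb := TopologicalSpace.isBasis_countableBasis X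
  have : Countable (TopologicalSpace.countableBasis X) :=
    (TopologicalSpace.countable_countableBasis X).to_subtype
  exact ⟨equivalence_rayRel hdist hG hgeo hbranch, hT,
    exists_crossSection_and_disintegration μ hT
      (A := fun U : TopologicalSpace.countableBasis X => {x | (rayOf dL Γ x ∩ U).Nonempty})
      (fun U => nullMeasurableSet_of_analyticSet μ
        (analyticSet_saturation hGa (hb.isOpen U.2)))
      fun x y => mem_rays_iff_forall_basis hdist hG hgeo hbranch hcont hloc hb x.2 y.2⟩
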